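/- **Setting.** Let $C_x\subset\mathbb R^n$, $C_u\subset\mathbb R^m$, let $F:C_x\times C_u\rightrightarrows\mathbb R^n$ and $\mathcal U:C_x\rightrightarrows C_u$ be set-valued maps, and consider the constrained control system $\Sigma_{\mathcal U}:\ \dot x\in F(x,u),\ u\in\mathcal U(x),\ x\in C_x$. Assume: (1) $C=C_x\times C_u$ is closed; (2) $F$ is upper semicontinuous on $C$ (for $p\in C$ and $\varepsilon>0$, $F(q)\subset F(p)+\varepsilon\mathbb B$ for all $q\in C$ near $p$) with nonempty, compact, convex values; (3) $\mathcal U$ is lower semicontinuous with nonempty, closed, convex values; (4) $F$ is convex in $u$: $C_u$ is convex and, for $x\in C_x$, $u_1,u_2\in C_u$, $\theta\in[0,1]$, $F(x,\theta u_1+(1-\theta)u_2)\subset\theta F(x,u_1)+(1-\theta)F(x,u_2)$; (5) $\mathcal U$ is outer semicontinuous (if $C_x\ni x_i\to x\in C_x$, $y_i\in\mathcal U(x_i)$, $y_i\to y$, then $y\in\mathcal U(x)$). For a locally Lipschitz $B:\mathbb R^n\to\mathbb R$ let $\partial_C B(x)$ be its Clarke generalized gradient (the convex hull of all limits of $\nabla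 B(x_i)$ with $x_i\to x$, $B$ differentiable at $x_i$), and put $$K=\{x: B(x)\le 0\}\cap C_x,\qquad g(x,u)=\sup\{\langle\zeta,\eta\rangle:\zeta\in\partial_C B(x),\ \eta\in F(x,u)\},$$ $$D_0(x)=\{u\in\mathcal U(x): g(x,u)<0\},\qquad \bar D_0(x)=\{u\in\mathcal U(x): g(x,u)\le 0\}.$$ Let $X_o\subset C_x$ and $X_u\subset\mathbb R^n$ be disjoint. $B$ is a control barrier function (CBF) with respect to $(X_o,X_u)$ if it is locally Lipschitz, $B>0$ on $X_u$, $B\le 0$ on $X_o$, and there is an open set $V\supset\partial K$ such that $$\inf_{u\in\mathcal U(x)}\ \sup_{\eta\in F(x,u),\ \zeta\in\partial_C B(x)}\langle\zeta,\eta\rangle\le 0\qquad(\ast)$$ for all $x\in(V\setminus\operatorname{int}K)\cap C_x$. A solution of $\dot x\in G(x)$, $x\in C_x$, is a locally absolutely continuous function $x:\operatorname{dom}x\to\mathbb R^n$ on an interval $\operatorname{dom}x\subset[0,\infty)$ containing $0$, with $x(0)\in\operatorname{cl}(C_x)$, $x(t)\in C_x$ for all $t\in\operatorname{int}(\operatorname{dom}x)$,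 and $\dot x(t)\in G(x(t))$ for almost all $t\in\operatorname{dom}x$. The inclusion is safe with respect to $(X_o,X_u)$ if every solution with $x(0)\in X_o$ satisfies $x(t)\notin X_u$ for all $t\in\operatorname{dom}x$. **Theorem.** Suppose (1)–(5) hold, let $B$ be a locally Lipschitz CBF with respect to $(X_o,X_u)$, and suppose that 1. $g:C_x\times C_u\to\mathbb R$ is convex in $u$; 2. there is an open set $V\supset\partial K$ such that $D_0(x)\neq\emptyset$ for all $x\in(V\setminus\operatorname{int}K)\cap C_x$. Let $U(K)\supset K$ be an open set such that, for every $x$ in $S_1=\operatorname{cl}\big((U(K)\setminus K)\cap C_x\big)$, $D_0(x)\ne\emptyset$ and $(\ast)$ holds. Suppose that $\widetilde{\mathcal U}:C_x\rightrightarrows C_u$ satisfies 3. $\widetilde{\mathcal U}$ is continuous (outer and lower semicontinuous) with nonempty, closed, convex values; 4. $\widetilde{\mathcal U}(x)\subset\bar D_0(x)$ for each $x\in S_1$; 5. $\widetilde{\mathcal U}(x)\subset\mathcal U(x)$ for each $x\in C_x$. Let $\mathcal L:\mathbb R^n\times\mathbb R^m\to\mathbb R$ be proper (automatic for a real-valued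 function), lower semicontinuous, convex in $(x,u)$, and strictly convex in $u$. Suppose that either $\mathcal L$ is sublevel bounded in $u$ (for every $x$ and every $\alpha\in\mathbb R$ the set $\{u:\mathcal L(x,u)\le\alpha\}$ is bounded), or $\widetilde{\mathcal U}(x)$ is bounded for each $x\in C_x$. Then for each $x\in C_x$ the problem of minimizing $\mathcal L(x,u)$ over $u\in\widetilde{\mathcal U}(x)$ has exactly one minimizer $\kappa^*(x)$; the map $\kappa^*$ is continuous on $\operatorname{int}(C_x)$; and the closed loop $\dot x\in F(x,\kappa^*(x))$, $x\in C_x$, is safe with respect to $(X_o,X_u)$. -/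

import Mathlib

open Set Filter Topology MeasureTheory

noncomputable section

namespace SafeControl

/-- The Euclidean space `ℝⁿ`. -/
abbrev Eucl (n : ℕ) : Type := EuclideanSpace ℝ (Fin n)

/-! ### Set-valued maps

A set-valued map on a set `C` is represented by a function `X → Set Y`, of which only the values
at points of `C` are used. Lower semicontinuity is Mathlib's `LowerHemicontinuousOn`. -/

/-- Outer semicontinuity on `C`: sequential closedness of the graph over every point of `C`. -/
def OuterSemicontOn {X Y : Type*} [TopologicalSpace X] [TopologicalSpace Y]
    (Φ : X → Set Y) (C : Set X) : Prop :=
  ∀ x ∈ C, ∀ (xs : ℕ → X) (ys : ℕ → Y) (y : Y),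
    (∀ i, xs i ∈ C) → (∀ i, ys i ∈ Φ (xs i)) →
    Tendsto xs atTop (𝓝 x) → Tendsto ys atTop (𝓝 y) → y ∈ Φ x

/-- Upper semicontinuity on `C`: for `x ∈ C` and `ε > 0`, one has `Φ y ⊆ Φ x + ε𝔹` for all
`y ∈ C` near `x`. -/
def UpperSemicontOn {X : Type*} [TopologicalSpace X] {n : ℕ}
    (Φ : X → Set (Eucl n)) (C : Set X) : Prop :=
  ∀ x ∈ C, ∀ ε > (0 : ℝ), ∀ᶠ y in 𝓝[C] x,
    ∀ v ∈ Φ y, ∃ w ∈ Φ x, dist v w ≤ ε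

/-- Continuity on `C` of a set-valued map: outer and lower semicontinuity. -/
def SetContinuousOn {X Y : Type*} [TopologicalSpace X] [TopologicalSpace Y]
    (Φ : X → Set Y) (C : Set X) : Prop :=
  OuterSemicontOn Φ C ∧ LowerHemicontinuousOn Φ C

/-- A set-valued map `Φ` is convex on `C`: the set `C` is convex and
`Φ (θ x + (1 - θ) y) ⊆ θ Φ x + (1 - θ) Φ y` for `x, y ∈ C` and `θ ∈ [0, 1]`. -/
def ConvexMapOn {n m : ℕ} (Φ : Eucl m → Set (Eucl n)) (C : Set (Eucl m)) : Prop :=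
  Convex ℝ C ∧ ∀ x ∈ C, ∀ y ∈ C, ∀ θ ∈ Icc (0 : ℝ) 1,
    ∀ v ∈ Φ (θ • x + (1 - θ) • y), ∃ a ∈ Φ x, ∃ b ∈ Φ y, v = θ • a + (1 - θ) • b

/-! ### Barrier functions -/

/-- The Clarke generalized gradient of a locally Lipschitz function: the convex hull of all limits
of gradients `∇ B (xᵢ)` along sequences `xᵢ → x` of points of differentiability of `B`. -/
def clarkeGradient {n : ℕ} (B : Eucl n → ℝ) (x : Eucl n) : Set (Eucl n) :=
  convexHull ℝ {ζ | ∃ xs : ℕ → Eucl n, Tendsto xs atTop (𝓝 x) ∧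
    (∀ i, DifferentiableAt ℝ B (xs i)) ∧
    Tendsto (fun i => gradient B (xs i)) atTop (𝓝 ζ)}

/-- `B` is positive on `Xu` and nonpositive on `Xo`. -/
def IsBarrierCandidate {n : ℕ} (B : Eucl n → ℝ) (Xo Xu : Set (Eucl n)) : Prop :=
  (∀ x ∈ Xu, 0 < B x) ∧ ∀ x ∈ Xo, B x ≤ 0

/-- The set `K = {x | B x ≤ 0} ∩ C_x`. -/
def safeSet {n : ℕ} (B : Eucl n → ℝ) (Cx : Set (Eucl n)) : Set (Eucl n) :=
  {x | B x ≤ 0} ∩ Cx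

/-- The barrier inequality at `x`:
`inf_{u ∈ 𝒰 x} sup_{η ∈ F (x, u), ζ ∈ ∂_C B x} ⟨ζ, η⟩ ≤ 0`, in the extended reals. -/
def BarrierInequality {n m : ℕ} (F : Eucl n × Eucl m → Set (Eucl n))
    (U : Eucl n → Set (Eucl m)) (B : Eucl n → ℝ) (x : Eucl n) : Prop :=
  (⨅ u ∈ U x, ⨆ η ∈ F (x, u), ⨆ ζ ∈ clarkeGradient B x, ((inner ℝ ζ η : ℝ) : EReal)) ≤ 0

/-- `B` is a (locally Lipschitz) control barrier function with respect to `(Xo, Xu)`: a locally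
Lipschitz barrier function candidate that satisfies the barrier inequality on
`(V \ int K) ∩ C_x` for some neighborhood `V` of `∂K`. -/
def IsCBF {n m : ℕ} (F : Eucl n × Eucl m → Set (Eucl n)) (Cx : Set (Eucl n))
    (U : Eucl n → Set (Eucl m)) (Xo Xu : Set (Eucl n)) (B : Eucl n → ℝ) : Prop :=
  LocallyLipschitz B ∧ IsBarrierCandidate B Xo Xu ∧
    ∃ V : Set (Eucl n), IsOpen V ∧ frontier (safeSet B Cx) ⊆ V ∧
      ∀ x ∈ (V \ interior (safeSet B Cx)) ∩ Cx, BarrierInequality F U B x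

/-- `g (x, u) = sup {⟨ζ, η⟩ | ζ ∈ ∂_C B x, η ∈ F (x, u)}`. -/
def gFun {n m : ℕ} (F : Eucl n × Eucl m → Set (Eucl n)) (B : Eucl n → ℝ)
    (x : Eucl n) (u : Eucl m) : ℝ :=
  sSup {r | ∃ ζ ∈ clarkeGradient B x, ∃ η ∈ F (x, u), r = inner ℝ ζ η}

/-- `D_0 (x) = {u ∈ 𝒰 x | g (x, u) < 0}`. -/
def D0 {n m : ℕ} (F : Eucl n × Eucl m → Set (Eucl n)) (U : Eucl n → Set (Eucl m))
    (B : Eucl n → ℝ) (x : Eucl n) : Set (Eucl m) :=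
  {u | u ∈ U x ∧ gFun F B x u < 0}

/-- `D̄_0 (x) = {u ∈ 𝒰 x | g (x, u) ≤ 0}`. -/
def D0bar {n m : ℕ} (F : Eucl n × Eucl m → Set (Eucl n)) (U : Eucl n → Set (Eucl m))
    (B : Eucl n → ℝ) (x : Eucl n) : Set (Eucl m) :=
  {u | u ∈ U x ∧ gFun F B x u ≤ 0}

/-- The outer neighborhood `S_1 = cl ((W \ K) ∩ C_x)` of `K` given by a neighborhood `W`. -/
def outerNhd {n : ℕ} (B : Eucl n → ℝ) (Cx W : Set (Eucl n)) : Set (Eucl n) :=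
  closure ((W \ safeSet B Cx) ∩ Cx)

/-! ### Solutions and safety -/

/-- `x`, with domain the interval `I ⊆ [0, ∞)` that contains `0`, is a solution of the constrained
differential inclusion `ẋ ∈ G x`, `x ∈ C_x`. Values of `x` outside `I` play no role: the boundary
points of `I` form a null set. -/
structure IsSolution {n : ℕ} (G : Eucl n → Set (Eucl n)) (Cx : Set (Eucl n))
    (I : Set ℝ) (x : ℝ → Eucl n) : Prop where
  dom_nonneg : I ⊆ Ici 0
  dom_interval : I.OrdConnected
  zero_mem : (0 : ℝ) ∈ I
  init : x 0 ∈ closure Cx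
  locallyAC : ∀ a ∈ I, ∀ b ∈ I, a ≤ b → AbsolutelyContinuousOnInterval x a b
  mem_state : ∀ t ∈ interior I, x t ∈ Cx
  deriv_mem : ∀ᵐ t ∂(volume.restrict I), ∃ v ∈ G (x t), HasDerivAt x v t

/-- The system `ẋ ∈ G x`, `x ∈ C_x` is safe with respect to `(Xo, Xu)`: no solution that starts in
`Xo` ever meets `Xu`. -/
def IsSafe {n : ℕ} (G : Eucl n → Set (Eucl n)) (Cx Xo Xu : Set (Eucl n)) : Prop :=
  ∀ (I : Set ℝ) (x : ℝ → Eucl n), IsSolution G Cx I x → x 0 ∈ Xo → ∀ t ∈ I, x t ∉ Xu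

/-! ### Optimization -/

/-- Sublevel boundedness of a function: every sublevel set is bounded. -/
def SublevelBounded {m : ℕ} (f : Eucl m → ℝ) : Prop :=
  ∀ α : ℝ, Bornology.IsBounded {u | f u ≤ α}

/-- The set of minimizers of `f` over `S`. -/
def argminSet {m : ℕ} (f : Eucl m → ℝ) (S : Set (Eucl m)) : Set (Eucl m) :=
  {u | u ∈ S ∧ IsMinOn f S u}

end SafeControl

end

open SafeControl

namespace SafeControl

open scoped NNReal

variable {n m : ℕ}

/-! If a closed-loop solution went from `Xo` to `Xu`, there would be a last time with `B ≤ 0`. Just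
after it the curve lies in `W \ K`, where every value of `Ut` makes `⟨ζ, η⟩ ≤ 0`. So `B` along the
curve, which is absolutely continuous, has derivative `≤ 0` a.e. and cannot become positive. The
delicate point is that `B` may be nondifferentiable all along the curve.
`hasDerivAt_comp_le_of_clarkeGradient_le` replaces the curve by its tangent line; by Rademacher and
Fubini, almost every parallel line meets the differentiability set almost everywhere, and continuity
then reaches the tangent line itself. The minimizer exists by compactness and is unique by strict
convexity. Its continuity needs no local bound on the constraint map: if `κ y` stays away from `κ
x`, convexity yields competitors on a fixed compact sphere around `κ x`, and their limit would be a
second minimizer at `x`. -/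

/-! ### Clarke gradients and the chain rule inequality. -/

/-- Near `x`, directional derivatives of a Lipschitz function exceed its Clarke directional bound
at `x` by arbitrarily little. -/
theorem exists_ball_fderiv_le_of_clarkeGradient_le {B : Eucl n → ℝ} {x v : Eucl n} {K : ℝ≥0}
    {s : Set (Eucl n)} (hs : s ∈ 𝓝 x) (hB : LipschitzOnWith K B s) {c ε : ℝ} (hε : 0 < ε)
    (hc : ∀ ζ ∈ clarkeGradient B x, inner ℝ ζ v ≤ c) :
    ∃ δ > 0, Metric.ball x δ ⊆ s ∧
      ∀ y ∈ Metric.ball x δ, DifferentiableAt ℝ B y → fderiv ℝ B y v ≤ c + ε := by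
  obtain ⟨r, hr, hrs⟩ := Metric.mem_nhds_iff.1 hs
  by_contra! hcon
  have key : ∀ k : ℕ, ∃ y ∈ Metric.ball x (min r (1 / (k + 1))),
      DifferentiableAt ℝ B y ∧ c + ε < fderiv ℝ B y v := fun k =>
    hcon _ (lt_min hr (by positivity)) ((Metric.ball_subset_ball (min_le_left _ _)).trans hrs)
  choose y hy hyd hyc using key
  have hyx : Tendsto y atTop (𝓝 x) := by
    refine tendsto_iff_dist_tendsto_zero.2 (squeeze_zero (fun _ => dist_nonneg) (fun k => ?_)
      tendsto_one_div_add_atTop_nhds_zero_nat)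
    exact (Metric.mem_ball.1 (hy k)).le.trans (min_le_right _ _)
  have hbdd : ∀ k, gradient B (y k) ∈ Metric.closedBall (0 : Eucl n) K := by
    intro k
    have hk : s ∈ 𝓝 (y k) := mem_of_superset (Metric.isOpen_ball.mem_nhds
      (Metric.ball_subset_ball (min_le_left _ _) (hy k))) hrs
    rw [mem_closedBall_zero_iff, gradient, LinearIsometryEquiv.norm_map]
    exact norm_fderiv_le_of_lipschitzOn ℝ hk hB
  -- Gradients are bounded by the Lipschitz constant, so a subsequence converges, and its limit is a
  -- Clarke gradient at `x` violating `hc`.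
  obtain ⟨ζ, -, φ, hφ, hζ⟩ := tendsto_subseq_of_bounded Metric.isBounded_closedBall hbdd
  have hmem : ζ ∈ clarkeGradient B x := subset_convexHull ℝ _
    ⟨y ∘ φ, hyx.comp hφ.tendsto_atTop, fun i => hyd _, hζ⟩
  have hge : c + ε ≤ inner ℝ ζ v := by
    refine ge_of_tendsto (hζ.inner tendsto_const_nhds) (Eventually.of_forall fun i => ?_)
    simpa [gradient] using (hyc (φ i)).le
  linarith [hc ζ hmem]

/-- A mean value inequality for Lipschitz functions in terms of almost-everywhere derivatives. -/
theorem sub_le_of_fderiv_le_of_lipschitzOnWith {B : Eucl n → ℝ} {s : Set (Eucl n)} {K : ℝ≥0}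
    (hs : IsOpen s) (hconv : Convex ℝ s) (hB : LipschitzOnWith K B s) {v : Eucl n} {c h : ℝ}
    (hd : ∀ y ∈ s, DifferentiableAt ℝ B y → fderiv ℝ B y v ≤ c) (hh : 0 ≤ h) {y : Eucl n}
    (hy : y ∈ s) (hyh : y + h • v ∈ s) : B (y + h • v) - B y ≤ h * c := by
  -- Adding `sᶜ` gives `D` full measure in the whole space, as Fubini along lines parallel to `v`
  -- requires.
  set D : Set (Eucl n) := {z | DifferentiableAt ℝ B z} ∪ sᶜ with hD
  have hDm : MeasurableSet D :=
    (measurableSet_of_differentiableAt ℝ B).union hs.measurableSet.compl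
  have hDae : ∀ᵐ z ∂(volume : Measure (Eucl n)), z ∈ D := by
    filter_upwards [hB.ae_differentiableWithinAt_of_mem (μ := volume)] with z hz
    by_cases hzs : z ∈ s
    · exact Or.inl ((hz hzs).differentiableAt (hs.mem_nhds hzs))
    · exact Or.inr hzs
  have hline : ∀ᵐ z ∂(volume : Measure (Eucl n)), ∀ᵐ t ∂(volume : Measure ℝ), z + t • v ∈ D := by
    simpa using (ae_ae_add_linearMap_mem_iff (LinearMap.toSpanSingleton ℝ (Eucl n) v)
      (volume : Measure ℝ) (volume : Measure (Eucl n)) hDm).2 hDae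
  set G : Set (Eucl n) := {z | ∀ᵐ t ∂(volume : Measure ℝ), z + t • v ∈ D} with hG
  have hGd : Dense G := Measure.dense_of_ae hline
  have good : ∀ z ∈ G, z ∈ s → z + h • v ∈ s → B (z + h • v) - B z ≤ h * c := by
    intro z hz hzs hzh
    have hseg : ∀ t ∈ Icc 0 h, z + t • v ∈ s := by
      intro t ht
      rcases hh.eq_or_lt with rfl | hpos
      · obtain rfl : t = 0 := le_antisymm ht.2 ht.1
        simpa using hzs
      · have := hconv.add_smul_mem hzs hzh
          (t := t / h) ⟨div_nonneg ht.1 hh, div_le_one_of_le₀ ht.2 hh⟩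
        rwa [smul_smul, div_mul_cancel₀ _ hpos.ne'] at this
    have hlip : LipschitzWith ‖v‖₊ (fun t : ℝ => z + t • v) :=
      LipschitzWith.of_dist_le_mul fun a b => by
        rw [dist_add_left, dist_eq_norm, ← sub_smul, norm_smul, mul_comm, ← dist_eq_norm]
        rfl
    have hac : AbsolutelyContinuousOnInterval (fun t : ℝ => B (z + t • v)) 0 h := by
      refine LipschitzOnWith.absolutelyContinuousOnInterval (K := K * ‖v‖₊) ?_
      refine hB.comp hlip.lipschitzOnWith ?_
      rw [uIcc_of_le hh]
      exact hseg
    have hFTC := hac.integral_deriv_eq_sub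
    have hle : ∫ t in (0 : ℝ)..h, deriv (fun t : ℝ => B (z + t • v)) t ≤ ∫ _ in (0 : ℝ)..h, c := by
      refine intervalIntegral.integral_mono_ae_restrict hh hac.intervalIntegrable_deriv
        intervalIntegrable_const ?_
      rw [EventuallyLE, ae_restrict_iff' measurableSet_Icc]
      filter_upwards [hz] with t ht htI
      have hts := hseg t htI
      have hdt : DifferentiableAt ℝ B (z + t • v) := ht.resolve_right (fun hn => hn hts)
      have hlin : HasDerivAt (fun t : ℝ => z + t • v) v t := by
        simpa using ((hasDerivAt_id t).smul_const v).const_add z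
      have hder : HasDerivAt (fun t : ℝ => B (z + t • v)) (fderiv ℝ B (z + t • v) v) t :=
        hdt.hasFDerivAt.comp_hasDerivAt t hlin
      rw [hder.deriv]
      exact hd _ hts hdt
    rw [hFTC] at hle
    simpa using hle
  -- The line through `y` itself may be exceptional; approach `y` by points of the dense set `G`.
  have hne : (𝓝[G] y).NeBot := mem_closure_iff_nhdsWithin_neBot.1 (hGd.closure_eq ▸ mem_univ y)
  have hcont : ∀ z ∈ s, ContinuousAt B z := fun z hz => hB.continuousOn.continuousAt (hs.mem_nhds hz)
  have hsh : ContinuousAt (fun z : Eucl n => z + h • v) y := by fun_prop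
  have hlim : ContinuousAt (fun z : Eucl n => B (z + h • v) - B z) y :=
    (ContinuousAt.comp (f := fun z : Eucl n => z + h • v) (hcont _ hyh) hsh).sub (hcont _ hy)
  refine le_of_tendsto (x := 𝓝[G] y) (hlim.tendsto.mono_left nhdsWithin_le_nhds) ?_
  filter_upwards [self_mem_nhdsWithin, nhdsWithin_le_nhds (hs.mem_nhds hy),
    nhdsWithin_le_nhds (hsh (hs.mem_nhds hyh))] with z h1 h2 h3 using good z h1 h2 h3

/-- Chain rule inequality: where both derivatives exist, the derivative of `B ∘ x` is at most any
bound for `⟨ζ, ẋ⟩`, `ζ` in the Clarke gradient. -/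
theorem hasDerivAt_comp_le_of_clarkeGradient_le {B : Eucl n → ℝ} (hB : LocallyLipschitz B)
    {x : ℝ → Eucl n} {v : Eucl n} {t d c : ℝ} (hx : HasDerivAt x v t)
    (hd : HasDerivAt (fun r => B (x r)) d t)
    (hc : ∀ ζ ∈ clarkeGradient B (x t), inner ℝ ζ v ≤ c) : d ≤ c := by
  obtain ⟨K, s, hs, hK⟩ := hB (x t)
  refine le_of_forall_pos_le_add fun ε hε => ?_
  obtain ⟨δ, hδ, hδs, hball⟩ := exists_ball_fderiv_le_of_clarkeGradient_le hs hK hε hc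
  have hlin : HasDerivAt (fun r : ℝ => x t + (r - t) • v) v t := by
    simpa using (((hasDerivAt_id t).sub_const t).smul_const v).const_add (x t)
  have hlt : Tendsto (fun r : ℝ => x t + (r - t) • v) (𝓝 t) (𝓝 (x t)) := by
    simpa using hlin.continuousAt.tendsto
  -- The curve and its tangent line differ by `o(r - t)`, hence so do their images under the
  -- Lipschitz `B`.
  have hdiff : HasDerivAt (fun r => B (x t + (r - t) • v) - B (x r)) 0 t := by
    rw [hasDerivAt_iff_isLittleO]
    have ho := (hasDerivAt_iff_isLittleO.1 (hlin.sub hx))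
    refine Asymptotics.IsBigO.trans_isLittleO (Asymptotics.IsBigO.of_bound K ?_) ho
    filter_upwards [hlt hs, hx.continuousAt hs] with r h1 h2
    simpa using hK.norm_sub_le h1 h2
  have hψ : HasDerivAt (fun r => B (x t + (r - t) • v)) d t := by
    have := hdiff.fun_add hd
    simpa only [sub_add_cancel, zero_add] using this
  have hslope := (hasDerivWithinAt_iff_tendsto_slope' self_notMem_Ioi).1
    (hψ.hasDerivWithinAt (s := Ioi t))
  refine le_of_tendsto hslope ?_
  filter_upwards [self_mem_nhdsWithin, nhdsWithin_le_nhds (hlt (Metric.ball_mem_nhds _ hδ))]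
    with r hr hrb
  have hr' : 0 < r - t := sub_pos.2 hr
  have := sub_le_of_fderiv_le_of_lipschitzOnWith Metric.isOpen_ball (convex_ball _ _)
    (hK.mono hδs) hball hr'.le (Metric.mem_ball_self hδ) hrb
  rw [slope_def_field, div_le_iff₀ hr']
  simpa [mul_comm] using this

/-! ### Safety from the sign of `⟨ζ, η⟩` outside `K`. -/

/-- A locally Lipschitz function of an absolutely continuous curve is absolutely continuous. -/
theorem _root_.LocallyLipschitz.comp_absolutelyContinuousOnInterval {X Y : Type*}
    [SeminormedAddCommGroup X] [PseudoMetricSpace Y] {B : X → Y} (hB : LocallyLipschitz B)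
    {x : ℝ → X} {a b : ℝ} (hx : AbsolutelyContinuousOnInterval x a b) :
    AbsolutelyContinuousOnInterval (fun t => B (x t)) a b := by
  -- The image of the curve is compact, so one Lipschitz constant serves for all of it.
  obtain ⟨K, hK⟩ := LocallyLipschitzOn.exists_lipschitzOnWith_of_compact
    (isCompact_uIcc.image_of_continuousOn hx.continuousOn) hB.locallyLipschitzOn
  have hK0 := Tendsto.const_mul (K : ℝ) hx
  rw [mul_zero] at hK0
  refine squeeze_zero' (Eventually.of_forall fun _ => Finset.sum_nonneg fun _ _ => dist_nonneg)
    ?_ hK0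
  rw [eventually_inf_principal]
  refine Eventually.of_forall fun E hE => ?_
  rw [Finset.mul_sum]
  exact Finset.sum_le_sum fun i hi => hK.dist_le_mul _ (mem_image_of_mem x (hE.1 i hi).1) _
    (mem_image_of_mem x (hE.1 i hi).2)

/-- The Clarke gradient of a locally Lipschitz function is bounded. -/
theorem isBounded_clarkeGradient {B : Eucl n → ℝ} (hB : LocallyLipschitz B) (x : Eucl n) :
    Bornology.IsBounded (clarkeGradient B x) := by
  obtain ⟨K, s, hs, hK⟩ := hB x
  refine Metric.isBounded_closedBall (x := (0 : Eucl n)) (r := K) |>.subset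
    (convexHull_min ?_ (convex_closedBall _ _))
  rintro ζ ⟨xs, hxs, -, hζ⟩
  refine Metric.isClosed_closedBall.mem_of_tendsto hζ ?_
  filter_upwards [hxs (eventually_mem_nhds_iff.2 hs)] with i hi
  rw [mem_closedBall_zero_iff, gradient, LinearIsometryEquiv.norm_map]
  exact norm_fderiv_le_of_lipschitzOn ℝ hi hK

/-- A real `sSup` is an upper bound only for a set bounded above; boundedness of the Clarke gradient
and of `F (x, u)` provides this by Cauchy–Schwarz. -/
theorem inner_le_gFun {F : Eucl n × Eucl m → Set (Eucl n)} {B : Eucl n → ℝ}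
    (hB : LocallyLipschitz B) {x : Eucl n} {u : Eucl m} (hF : Bornology.IsBounded (F (x, u)))
    {ζ η : Eucl n} (hζ : ζ ∈ clarkeGradient B x) (hη : η ∈ F (x, u)) :
    inner ℝ ζ η ≤ gFun F B x u := by
  obtain ⟨a, ha⟩ := (isBounded_clarkeGradient hB x).exists_norm_le
  obtain ⟨b, hb⟩ := hF.exists_norm_le
  refine le_csSup ⟨a * b, ?_⟩ ⟨ζ, hζ, η, hη, rfl⟩
  rintro _ ⟨ζ', hζ', η', hη', rfl⟩
  exact (real_inner_le_norm _ _).trans (mul_le_mul (ha _ hζ') (hb _ hη') (norm_nonneg _)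
    ((norm_nonneg _).trans (ha _ hζ')))

/-- If `⟨ζ, η⟩ ≤ 0` for all velocities `η` and Clarke gradients `ζ` of `B` just outside
`{B ≤ 0}`, then the inclusion is safe. -/
theorem isSafe_of_inner_clarkeGradient_nonpos {G : Eucl n → Set (Eucl n)}
    {Cx Xo Xu W : Set (Eucl n)} {B : Eucl n → ℝ} (hCx : IsClosed Cx) (hB : LocallyLipschitz B)
    (hcand : IsBarrierCandidate B Xo Xu) (hW : IsOpen W) (hKW : safeSet B Cx ⊆ W)
    (hG : ∀ x ∈ (W \ safeSet B Cx) ∩ Cx, ∀ η ∈ G x, ∀ ζ ∈ clarkeGradient B x,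
      inner ℝ ζ η ≤ 0) :
    IsSafe G Cx Xo Xu := by
  intro I x hsol hx0 t₁ ht₁ hxt₁
  have ht₁0 : 0 ≤ t₁ := hsol.dom_nonneg ht₁
  have hsub : Icc 0 t₁ ⊆ I := hsol.dom_interval.out hsol.zero_mem ht₁
  have hAC := hsol.locallyAC 0 hsol.zero_mem t₁ ht₁ ht₁0
  have hxc : ContinuousOn x (Icc 0 t₁) := by simpa [uIcc_of_le ht₁0] using hAC.continuousOn
  have hfc : ContinuousOn (fun t => B (x t)) (Icc 0 t₁) := hB.continuous.comp_continuousOn hxc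
  -- The state constraint is imposed only at interior times; time `0` is recovered from closedness
  -- of `Cx`.
  have hmem : ∀ t ∈ Ico 0 t₁, x t ∈ Cx := by
    intro t ht
    rcases ht.1.eq_or_lt with rfl | hpos
    · exact hCx.closure_eq ▸ hsol.init
    · exact hsol.mem_state t (mem_interior.2 ⟨Ioo 0 t₁, Ioo_subset_Icc_self.trans hsub,
        isOpen_Ioo, hpos, ht.2⟩)
  -- `t₀` is the last time at which `B ≤ 0`.
  obtain ⟨t₀, ⟨ht₀I, ht₀⟩, hmax⟩ : ∃ t₀, IsGreatest (Icc 0 t₁ ∩ (fun t => B (x t)) ⁻¹' Iic 0) t₀ :=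
    (isCompact_Icc.of_isClosed_subset (hfc.preimage_isClosed_of_isClosed isClosed_Icc isClosed_Iic)
      inter_subset_left).exists_isGreatest ⟨0, ⟨le_rfl, ht₁0⟩, hcand.2 _ hx0⟩
  have ht₀1 : t₀ < t₁ := ht₀I.2.lt_of_ne fun h => by
    subst h
    exact absurd ht₀ (not_le.2 (hcand.1 _ hxt₁))
  have hpos : ∀ t ∈ Ioc t₀ t₁, 0 < B (x t) := fun t ht => by
    by_contra! hle
    exact absurd (hmax ⟨⟨ht₀I.1.trans ht.1.le, ht.2⟩, hle⟩) (not_le.2 ht.1)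
  have hx₀W : W ∈ 𝓝 (x t₀) := hW.mem_nhds (hKW ⟨ht₀, hmem t₀ ⟨ht₀I.1, ht₀1⟩⟩)
  have hev : ∀ᶠ t in 𝓝[>] t₀, x t ∈ W :=
    ((hxc t₀ ht₀I).mono_of_mem_nhdsWithin (mem_of_superset (Ioc_mem_nhdsGT ht₀1)
      fun t ht => ⟨ht₀I.1.trans ht.1.le, ht.2⟩)) hx₀W
  obtain ⟨t₂, ⟨ht₂, ht₂1⟩, hW₂⟩ := (mem_nhdsGT_iff_exists_mem_Ioc_Ioo_subset ht₀1).1 hev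
  have hsub₂ : uIcc t₀ t₂ ⊆ uIcc 0 t₁ := by
    rw [uIcc_of_le ht₁0, uIcc_of_le ht₂.le]
    exact Icc_subset_Icc ht₀I.1 ht₂1
  have hfAC : AbsolutelyContinuousOnInterval (fun t => B (x t)) t₀ t₂ :=
    hB.comp_absolutelyContinuousOnInterval (hAC.mono hsub₂)
  have hderiv : ∀ᵐ t ∂(volume.restrict I), ∃ v ∈ G (x t), HasDerivAt x v t := hsol.deriv_mem
  have hderiv' : ∀ᵐ t ∂(volume : Measure ℝ), t ∈ I → ∃ v ∈ G (x t), HasDerivAt x v t :=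
    (ae_restrict_iff' hsol.dom_interval.measurableSet).1 hderiv
  have hle : ∫ t in t₀..t₂, deriv (fun t => B (x t)) t ≤ 0 := by
    rw [intervalIntegral.integral_of_le ht₂.le, integral_Ioc_eq_integral_Ioo]
    refine integral_nonpos_of_ae ?_
    rw [EventuallyLE, ae_restrict_iff' measurableSet_Ioo]
    filter_upwards [hderiv', hfAC.ae_differentiableAt] with t h1 h2 ht
    have htI : t ∈ Icc 0 t₁ := ⟨ht₀I.1.trans ht.1.le, ht.2.le.trans ht₂1⟩
    obtain ⟨v, hv, hxv⟩ := h1 (hsub htI)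
    refine hasDerivAt_comp_le_of_clarkeGradient_le hB hxv
      (h2 (uIcc_of_le ht₂.le ▸ Ioo_subset_Icc_self ht)).hasDerivAt fun ζ hζ => ?_
    refine hG (x t) ⟨⟨hW₂ ht, fun hK => ?_⟩, hmem t ⟨htI.1, ht.2.trans_le ht₂1⟩⟩ v hv ζ hζ
    exact absurd hK.1 (not_le.2 (hpos t ⟨ht.1, htI.2⟩))
  rw [hfAC.integral_deriv_eq_sub] at hle
  have h₂ := hpos t₂ ⟨ht₂, ht₂1⟩
  have h₀ : B (x t₀) ≤ 0 := ht₀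
  linarith

/-! ### Existence, uniqueness and continuity of the minimizer. -/

/-- A strictly convex function on `ℝᵐ` has exactly one minimizer over a nonempty closed convex set
if it is sublevel bounded or the set is bounded. -/
theorem exists_argminSet_eq_singleton {f : Eucl m → ℝ} (hf : StrictConvexOn ℝ univ f)
    {S : Set (Eucl m)} (hne : S.Nonempty) (hcl : IsClosed S) (hconv : Convex ℝ S)
    (hbdd : SublevelBounded f ∨ Bornology.IsBounded S) : ∃ u, argminSet f S = {u} := by
  have hcont : Continuous f := hf.convexOn.locallyLipschitz.continuous
  obtain ⟨u₀, hu₀⟩ := hne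
  obtain ⟨u, huS, hu⟩ : ∃ u ∈ S, IsMinOn f S u := by
    have hcpt : IsCompact (S ∩ {u | f u ≤ f u₀}) :=
      Metric.isCompact_of_isClosed_isBounded
        (hcl.inter (isClosed_le hcont continuous_const))
        (hbdd.elim (fun h => (h (f u₀)).subset inter_subset_right)
          fun h => h.subset inter_subset_left)
    obtain ⟨u, hu, hmin⟩ := hcpt.exists_isMinOn ⟨u₀, hu₀, le_refl (f u₀)⟩ hcont.continuousOn
    refine ⟨u, hu.1, fun w hw => ?_⟩
    rcases le_total (f w) (f u₀) with h | h
    · exact hmin ⟨hw, h⟩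
    · exact hu.2.trans h
  refine ⟨u, eq_singleton_iff_unique_mem.2 ⟨⟨huS, hu⟩, fun w hw => ?_⟩⟩
  exact (hf.subset (subset_univ S) hconv).eq_of_isMinOn hw.2 hu hw.1 huS

/-- The unique minimizer of a jointly continuous cost, quasiconvex in `u`, over a continuous
convex-valued constraint map depends continuously on the parameter. -/
theorem continuousOn_of_argminSet_eq_singleton {C : Set (Eucl n)} {Φ : Eucl n → Set (Eucl m)}
    (hΦ : SetContinuousOn Φ C) (hconv : ∀ x ∈ C, Convex ℝ (Φ x)) {L : Eucl n → Eucl m → ℝ}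
    (hL : Continuous fun p : Eucl n × Eucl m => L p.1 p.2) (hLc : ∀ x, ConvexOn ℝ univ (L x))
    {κ : Eucl n → Eucl m} (hκ : ∀ x ∈ C, argminSet (L x) (Φ x) = {κ x}) : ContinuousOn κ C := by
  have hκm : ∀ x ∈ C, κ x ∈ argminSet (L x) (Φ x) := fun x hx => by
    rw [hκ x hx]; exact mem_singleton _
  intro x hx
  by_contra hnot
  obtain ⟨ε, hε, hfreq⟩ : ∃ ε > 0, ∃ᶠ y in 𝓝[C] x, ε ≤ dist (κ y) (κ x) := by
    simpa [ContinuousWithinAt, Metric.tendsto_nhds] using hnot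
  -- Lower semicontinuity gives `v ∈ Φ y` near `κ x`, inside the sphere, while `κ y` is on or
  -- outside it. The segment from `v` to `κ y` meets the sphere at some `w ∈ Φ y`, and convexity
  -- bounds the cost at `w` by the larger end value, which is the one at `v`.
  have key : ∀ k : ℕ, ∃ y ∈ C, dist y x < 1 / (k + 1) ∧ ∃ v, dist v (κ x) < 1 / (k + 1) ∧
      ∃ w ∈ Metric.sphere (κ x) ε, w ∈ Φ y ∧ L y w ≤ L y v := by
    intro k
    have hk : (0 : ℝ) < 1 / (k + 1) := by positivity
    have hlsc := lowerHemicontinuousWithinAt_iff.1 (hΦ.2 x hx)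
      (Metric.ball (κ x) (min ε (1 / (k + 1)))) Metric.isOpen_ball
      ⟨κ x, (hκm x hx).1, Metric.mem_ball_self (lt_min hε hk)⟩
    have hnear : ∀ᶠ y in 𝓝[C] x, y ∈ Metric.ball x (1 / (k + 1)) :=
      nhdsWithin_le_nhds (Metric.ball_mem_nhds x hk)
    obtain ⟨y, hyε, ⟨v, hvΦ, hv⟩, hyC, hyx⟩ := (hfreq.and_eventually (hlsc.and
      (eventually_mem_nhdsWithin.and hnear))).exists
    have hv' := Metric.mem_ball.1 hv
    obtain ⟨w, hw, hwε⟩ := (convex_segment (𝕜 := ℝ) v (κ y)).isPreconnected.intermediate_value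
      (left_mem_segment ℝ _ _) (right_mem_segment ℝ _ _)
      (f := fun w => dist w (κ x)) (by fun_prop) ⟨(hv'.trans_le (min_le_left _ _)).le, hyε⟩
    refine ⟨y, hyC, hyx, v, hv'.trans_le (min_le_right _ _), w, hwε,
      (hconv y hyC).segment_subset hvΦ (hκm y hyC).1 hw, ?_⟩
    exact ((hLc y).le_on_segment (mem_univ _) (mem_univ _) hw).trans
      (max_le le_rfl ((hκm y hyC).2 hvΦ))
  choose y hyC hyx v hv w hwε hwΦ hLw using key
  have hy : Tendsto y atTop (𝓝 x) := tendsto_iff_dist_tendsto_zero.2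
    (squeeze_zero (fun _ => dist_nonneg) (fun k => (hyx k).le)
      tendsto_one_div_add_atTop_nhds_zero_nat)
  have hvκ : Tendsto v atTop (𝓝 (κ x)) := tendsto_iff_dist_tendsto_zero.2
    (squeeze_zero (fun _ => dist_nonneg) (fun k => (hv k).le)
      tendsto_one_div_add_atTop_nhds_zero_nat)
  obtain ⟨w₀, hw₀, φ, hφ, hwφ⟩ := (isCompact_sphere (κ x) ε).tendsto_subseq hwε
  have hyφ := hy.comp hφ.tendsto_atTop
  have hvφ := hvκ.comp hφ.tendsto_atTop
  have hw₀Φ : w₀ ∈ Φ x :=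
    hΦ.1 x hx (y ∘ φ) (w ∘ φ) w₀ (fun i => hyC _) (fun i => hwΦ _) hyφ hwφ
  have hle : L x w₀ ≤ L x (κ x) := le_of_tendsto_of_tendsto'
    ((hL.tendsto (x, w₀)).comp (hyφ.prodMk_nhds hwφ))
    ((hL.tendsto (x, κ x)).comp (hyφ.prodMk_nhds hvφ)) fun i => hLw (φ i)
  -- Uniqueness forces `w₀ = κ x`, although `w₀` lies at distance `ε > 0` from it.
  have hw₀m : w₀ ∈ argminSet (L x) (Φ x) :=
    ⟨hw₀Φ, fun u hu => hle.trans ((hκm x hx).2 hu)⟩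
  rw [hκ x hx, mem_singleton_iff] at hw₀m
  subst hw₀m
  simp only [mem_sphere_iff_norm, sub_self, norm_zero] at hw₀
  exact hε.ne hw₀

end SafeControl

/-! ### The closed loop. -/

theorem theorem2 {n m : ℕ}
    -- state constraint set, input constraint set, flow map, admissible inputs
    (Cx : Set (Eucl n)) (Cu : Set (Eucl m))
    (F : Eucl n × Eucl m → Set (Eucl n)) (U : Eucl n → Set (Eucl m))
    (hC : IsClosed (Cx ×ˢ Cu))
    (hF_usc : UpperSemicontOn F (Cx ×ˢ Cu))
    (hF_val : ∀ p ∈ Cx ×ˢ Cu, (F p).Nonempty ∧ IsCompact (F p) ∧ Convex ℝ (F p))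
    (hU_maps : ∀ x ∈ Cx, U x ⊆ Cu)
    (hU_lsc : LowerHemicontinuousOn U Cx)
    (hU_val : ∀ x ∈ Cx, (U x).Nonempty ∧ IsClosed (U x) ∧ Convex ℝ (U x))
    (hF_conv : ∀ x ∈ Cx, ConvexMapOn (fun u => F (x, u)) Cu)
    (hU_osc : OuterSemicontOn U Cx)
    -- initial set, unsafe set, control barrier function
    (Xo Xu : Set (Eucl n)) (hXo : Xo ⊆ Cx) (hXoXu : Disjoint Xo Xu)
    (B : Eucl n → ℝ) (hB : IsCBF F Cx U Xo Xu B)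
    (hg : ∀ x ∈ Cx, ConvexOn ℝ Cu (gFun F B x))
    (hD0 : ∃ V : Set (Eucl n), IsOpen V ∧ frontier (safeSet B Cx) ⊆ V ∧
      ∀ x ∈ (V \ interior (safeSet B Cx)) ∩ Cx, (D0 F U B x).Nonempty)
    -- the neighborhood of `K` that defines `S_1`
    (W : Set (Eucl n)) (hW : IsOpen W) (hKW : safeSet B Cx ⊆ W)
    (hS_D0 : ∀ x ∈ outerNhd B Cx W, (D0 F U B x).Nonempty)
    (hS_cbf : ∀ x ∈ outerNhd B Cx W, BarrierInequality F U B x)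
    -- the continuous constraint map
    (Ut : Eucl n → Set (Eucl m))
    (hUt_cont : SetContinuousOn Ut Cx)
    (hUt_val : ∀ x ∈ Cx, (Ut x).Nonempty ∧ IsClosed (Ut x) ∧ Convex ℝ (Ut x))
    (hUt_S : ∀ x ∈ outerNhd B Cx W, Ut x ⊆ D0bar F U B x)
    (hUt_U : ∀ x ∈ Cx, Ut x ⊆ U x)
    -- the cost; being real-valued, it is proper
    (L : Eucl n → Eucl m → ℝ)
    (hL_lsc : LowerSemicontinuous (fun p : Eucl n × Eucl m => L p.1 p.2))
    (hL_conv : ConvexOn ℝ univ (fun p : Eucl n × Eucl m => L p.1 p.2))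
    (hL_strict : ∀ x, StrictConvexOn ℝ univ (L x))
    (hL_bdd : (∀ x, SublevelBounded (L x)) ∨ ∀ x ∈ Cx, Bornology.IsBounded (Ut x)) :
    ∃ κ : Eucl n → Eucl m,
      (∀ x ∈ Cx, argminSet (L x) (Ut x) = {κ x}) ∧
      ContinuousOn κ (interior Cx) ∧
      IsSafe (fun x => F (x, κ x)) Cx Xo Xu := by
  obtain ⟨hBlip, hcand, -⟩ := hB
  have hCx : IsClosed Cx := by
    rcases Cx.eq_empty_or_nonempty with rfl | ⟨x, hx⟩
    · exact isClosed_empty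
    · obtain ⟨u, hu⟩ := (hU_val x hx).1
      -- `Cx` is the slice of the closed product at an input `u ∈ Cu`.
      have hpre : Cx = (fun y => (y, u)) ⁻¹' (Cx ×ˢ Cu) := by
        ext y; simp [hU_maps x hx hu]
      rw [hpre]
      exact hC.preimage (by fun_prop)
  have hex : ∀ x, ∃ u, x ∈ Cx → argminSet (L x) (Ut x) = {u} := by
    intro x
    by_cases hx : x ∈ Cx
    · obtain ⟨hne, hcl, hconv⟩ := hUt_val x hx
      obtain ⟨u, hu⟩ := exists_argminSet_eq_singleton (hL_strict x) hne hcl hconv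
        (hL_bdd.imp (fun h => h x) fun h => h x hx)
      exact ⟨u, fun _ => hu⟩
    · exact ⟨0, fun h => absurd h hx⟩
  choose κ hκ using hex
  -- A finite convex function on a finite-dimensional space is locally Lipschitz, so `L` is jointly
  -- continuous.
  refine ⟨κ, hκ, (continuousOn_of_argminSet_eq_singleton hUt_cont (fun x hx => (hUt_val x hx).2.2)
    hL_conv.locallyLipschitz.continuous (fun x => (hL_strict x).convexOn) hκ).mono
    interior_subset, ?_⟩
  refine isSafe_of_inner_clarkeGradient_nonpos hCx hBlip hcand hW hKW fun x hx η hη ζ hζ => ?_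
  have hκU : κ x ∈ Ut x := by
    have : κ x ∈ argminSet (L x) (Ut x) := by rw [hκ x hx.2]; exact mem_singleton _
    exact this.1
  have hκC : κ x ∈ Cu := hU_maps x hx.2 (hUt_U x hx.2 hκU)
  exact (inner_le_gFun hBlip (hF_val (x, κ x) ⟨hx.2, hκC⟩).2.1.isBounded hζ hη).trans
    (hUt_S x (subset_closure hx) hκU).2
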